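/- Let $Y$ be an infinite-dimensional normed space over $\mathbf{K}=\mathbf{R}$ or $\mathbf{C}$ (not assumed complete). A \emph{linear relation} on $Y$ is a multivalued map $h$ assigning to each $x\in Y$ a nonempty set $h(x)\subset Y$ such that $h(ax)=a\,h(x)$ and $h(x+y)=h(x)+h(y)$ for all $x,y\in Y$ and all $a\in\mathbf{K}\setminus\{0\}$; then $h(0)$ is a linear subspace. For $B\subset Y$ put $h(B)=\bigcup_{x\in B}h(x)$ and $h^{-1}(B)=\{x\in Y: h(x)\cap B\neq\emptyset\}$. The relation $h$ is \emph{continuous} if $h^{-1}(B)$ is open for every open $B\subset Y$. Let $LR_0(Y)$ be the set of continuous linear relations $h$ on $Y$ with $\dim h(0)<\infty$. A relation $k\in LR_0(Y)$ is \emph{compact} if, with $Q_k:Y\to Y/k(0)$ the quotient map, the single-valued operator $Q_kk$ maps every bounded set into a compact set. \textbf{Theorem.} Let $h,k\in LR_0(Y)$. Suppose that $k$ is compact, that $k$ commutes with $h$ in the sense that $h(k(x))\subset k(h(x))$ for all $x\in Y$, and that $k^{-1}(\{0\})\neq Y$. Then there is a closed linear subspace $M\subset Y$ with $M\neq\{0\}$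 and $M\neq Y$ which is $h$-weakly-invariant, i.e. $h(x)\cap M\neq\emptyset$ for all $x\in M$. -/

import Mathlib

open scoped Pointwise

/-- A linear relation between `𝕜`-vector spaces: a multivalued map with nonempty values that
preserves sums and nonzero scalar multiples, where sums and multiples of sets are taken
elementwise. -/
structure LinearRelation (𝕜 X Y : Type*) [Field 𝕜] [AddCommGroup X] [Module 𝕜 X]
    [AddCommGroup Y] [Module 𝕜 Y] where
  /-- the set of values at a point -/
  toFun : X → Set Y
  nonempty' : ∀ x, (toFun x).Nonempty
  map_smul' : ∀ a : 𝕜, a ≠ 0 → ∀ x, toFun (a • x) = a • toFun x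
  map_add' : ∀ x y, toFun (x + y) = toFun x + toFun y

namespace LinearRelation

section Algebra

variable {𝕜 X Y Z : Type*} [Field 𝕜] [AddCommGroup X] [Module 𝕜 X]
  [AddCommGroup Y] [Module 𝕜 Y] [AddCommGroup Z] [Module 𝕜 Z]

instance : CoeFun (LinearRelation 𝕜 X Y) (fun _ => X → Set Y) := ⟨LinearRelation.toFun⟩

theorem add_mem_zero (T : LinearRelation 𝕜 X Y) {u v : Y} (hu : u ∈ T 0) (hv : v ∈ T 0) :
    u + v ∈ T 0 := by
  have h := T.map_add' 0 0
  rw [add_zero] at h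
  rw [h]
  exact Set.add_mem_add hu hv

theorem smul_mem_zero (T : LinearRelation 𝕜 X Y) {a : 𝕜} (ha : a ≠ 0) {u : Y} (hu : u ∈ T 0) :
    a • u ∈ T 0 := by
  have h := T.map_smul' a ha 0
  rw [smul_zero] at h
  rw [h]
  exact Set.smul_mem_smul_set hu

theorem zero_mem_zero (T : LinearRelation 𝕜 X Y) : (0 : Y) ∈ T 0 := by
  obtain ⟨u, hu⟩ := T.nonempty' 0
  have h1 : (-1 : 𝕜) • u ∈ T 0 := T.smul_mem_zero (neg_ne_zero.mpr one_ne_zero) hu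
  have h2 := T.add_mem_zero hu h1
  simpa using h2

/-- The set `T(0)`, which is a linear subspace. -/
def zeroValue (T : LinearRelation 𝕜 X Y) : Submodule 𝕜 Y where
  carrier := T 0
  add_mem' := T.add_mem_zero
  zero_mem' := T.zero_mem_zero
  smul_mem' := by
    intro a u hu
    by_cases ha : a = 0
    · subst ha
      simpa using T.zero_mem_zero
    · exact T.smul_mem_zero ha hu

/-- The image `T(B)` of a set `B`. -/
def image (T : LinearRelation 𝕜 X Y) (B : Set X) : Set Y := ⋃ x ∈ B, T x

/-- The inverse image `T⁻¹(B) = {x | T(x) ∩ B ≠ ∅}` of a set `B`. -/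
def preimage (T : LinearRelation 𝕜 X Y) (B : Set Y) : Set X := {x | (T x ∩ B).Nonempty}

/-- The composition `hk`, with values `(hk)(x) = h(k(x))`, as a multivalued map. -/
def compValue (h : LinearRelation 𝕜 Y Z) (k : LinearRelation 𝕜 X Y) (x : X) : Set Z :=
  h.image (k x)

/-- `k` commutes with `h`: `hk ⊆ kh`. -/
def CommutesWith (k h : LinearRelation 𝕜 X X) : Prop :=
  ∀ x, h.compValue k x ⊆ k.compValue h x

/-- `M` is `h`-weakly-invariant: `h(x) ∩ M ≠ ∅` for all `x ∈ M`. -/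
def WeaklyInvariant (h : LinearRelation 𝕜 X X) (M : Submodule 𝕜 X) : Prop :=
  ∀ x ∈ M, (h x ∩ (M : Set X)).Nonempty

end Algebra

section Topology

variable {𝕜 X Y : Type*} [RCLike 𝕜] [NormedAddCommGroup X] [NormedSpace 𝕜 X]
  [NormedAddCommGroup Y] [NormedSpace 𝕜 Y]

/-- Continuity of a linear relation in the standard sense of the theory of linear relations:
the inverse image of every open set is open (lower semicontinuity). -/
def Continuous (T : LinearRelation 𝕜 X Y) : Prop :=
  ∀ B : Set Y, IsOpen B → IsOpen (T.preimage B)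

/-- The class `LR₀`: continuous linear relations `T` with `dim T(0) < ∞`. -/
structure IsLR0 (T : LinearRelation 𝕜 X Y) : Prop where
  continuous : T.Continuous
  finiteDimensional : FiniteDimensional 𝕜 T.zeroValue

/-- `T` is compact: with `Q` the quotient map of `Y` onto `Y / T(0)`, the single-valued
operator `QT` maps every bounded set into a compact set. -/
def Compact (T : LinearRelation 𝕜 X Y) : Prop :=
  ∀ B : Set X, Bornology.IsBounded B →
    ∃ C : Set (Y ⧸ T.zeroValue), IsCompact C ∧ T.zeroValue.mkQ '' T.image B ⊆ C

end Topology

end LinearRelation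

/-!
If `h 0 ≠ {0}`, a closed hyperplane `M` not containing `h 0` satisfies `M + h 0 = Y` and is weakly
invariant. If `h 0 = {0}` but `k 0 ≠ {0}`, then `h` is an operator, and commutation gives
`h (k 0) ⊆ k (h 0) = k 0`, so the finite-dimensional space `k 0` is invariant. There remains the
case of commuting bounded operators `H` and `K` with `K` compact and nonzero, which is the theorem
of Lomonosov, over `ℝ` as well as `ℂ` and without completeness.

In that case even every operator commuting with `K` leaves a common closed subspace invariant
(`IsCompactOperator.exists_hyperinvariant`). There are two possibilities for `K`, viewed as a
real-linear operator (`IsCompactOperator.exists_quadratic_or_tendsto`).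

* The extension of `K` to the complexified completion has a nonzero eigenvalue `z`. Since a compact
  operator extends to the completion with values in the original space, this produces a nonzero
  vector of `Y` in the kernel of `q(K)`, where `q` is the real quadratic polynomial with roots `z`
  and its conjugate. This kernel is closed and invariant under the commutant of `K`, and it is not
  all of `Y`: because `q(0) ≠ 0`, the identity would be compact.
* There is no such eigenvalue. By the Fredholm alternative the extension has spectrum contained in
  `{0}`, so by Gelfand's formula `K` is quasinilpotent. Hilden's argument
  (`exists_not_tendsto_of_dense_orbits`) then shows that the commutant of `K` cannot act with dense
  orbits, and the closure of a non-dense orbit is the required subspace.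
-/

open Filter Topology UniformSpace

/-! ### Complexification -/

/-- The complexification of a real normed space `E`, realised as the space of real-linear maps
`ℂ → E` with the operator norm. The map `f` stands for `f 1 - i • f i`, and a complex scalar acts by
multiplication on the domain; with this model the operator norm is a complex norm at once. -/
def Complexification (E : Type*) [NormedAddCommGroup E] [NormedSpace ℝ E] : Type _ := ℂ →L[ℝ] E

namespace Complexification

variable {E : Type*} [NormedAddCommGroup E] [NormedSpace ℝ E]

noncomputable instance : NormedAddCommGroup (Complexification E) :=
  inferInstanceAs (NormedAddCommGroup (ℂ →L[ℝ] E))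

instance [CompleteSpace E] : CompleteSpace (Complexification E) :=
  inferInstanceAs (CompleteSpace (ℂ →L[ℝ] E))

noncomputable instance : Module ℂ (Complexification E) where
  smul c f := ContinuousLinearMap.comp (show ℂ →L[ℝ] E from f) (ContinuousLinearMap.mul ℝ ℂ c)
  one_smul f := ContinuousLinearMap.ext fun z => congrArg (show ℂ →L[ℝ] E from f) (one_mul z)
  mul_smul c d f := ContinuousLinearMap.ext fun z =>
    congrArg (show ℂ →L[ℝ] E from f) (show c * d * z = d * (c * z) by ring)
  smul_zero c := rfl
  smul_add c f g := rfl
  add_smul c d f := ContinuousLinearMap.ext fun z =>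
    (congrArg (show ℂ →L[ℝ] E from f) (add_mul c d z)).trans (map_add _ _ _)
  zero_smul f := ContinuousLinearMap.ext fun z =>
    (congrArg (show ℂ →L[ℝ] E from f) (zero_mul z)).trans (map_zero _)

noncomputable instance : NormedSpace ℂ (Complexification E) where
  norm_smul_le c f :=
    (ContinuousLinearMap.opNorm_comp_le (show ℂ →L[ℝ] E from f)
      (ContinuousLinearMap.mul ℝ ℂ c)).trans (by
        rw [mul_comm]
        exact mul_le_mul_of_nonneg_right (ContinuousLinearMap.opNorm_mul_apply_le ℝ ℂ c)
          (norm_nonneg f))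

/-- The value of an element of the complexification, as a real-linear map, at `z`. -/
noncomputable def eval (z : ℂ) (f : Complexification E) : E := (show ℂ →L[ℝ] E from f) z

theorem continuous_eval (z : ℂ) : Continuous (eval z : Complexification E → E) :=
  (ContinuousLinearMap.apply ℝ E z).continuous

/-- The complex-linear extension of a real-linear operator, acting by composition. -/
noncomputable def map (T : E →L[ℝ] E) : Complexification E →L[ℂ] Complexification E where
  toFun f := T.comp (show ℂ →L[ℝ] E from f)
  map_add' _ _ := ContinuousLinearMap.comp_add T _ _
  map_smul' _ _ := rfl
  cont := (ContinuousLinearMap.compL ℝ ℂ E E T).continuous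

/-- The element of the complexification with real part `x` and imaginary part `0`. -/
noncomputable def ofReal (x : E) : Complexification E := Complex.reCLM.smulRight x

theorem norm_ofReal (x : E) : ‖ofReal x‖ = ‖x‖ := by
  refine (ContinuousLinearMap.norm_smulRight_apply Complex.reCLM x).trans ?_
  rw [Complex.reCLM_norm, one_mul]

theorem map_ofReal (T : E →L[ℝ] E) (x : E) : map T (ofReal x) = ofReal (T x) :=
  ContinuousLinearMap.ext fun z => T.map_smul z.re x

theorem map_pow_ofReal (T : E →L[ℝ] E) (n : ℕ) (x : E) :
    (map T ^ n) (ofReal x) = ofReal ((T ^ n) x) := by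
  induction n with
  | zero => rfl
  | succ n ih => simp only [pow_succ', mul_apply_eq_comp, ih, map_ofReal]

theorem isCompactOperator_map {T : E →L[ℝ] E} (hT : IsCompactOperator T) :
    IsCompactOperator (map T) := by
  obtain ⟨C, hC, hC0⟩ := hT
  let Φ : E × E → Complexification E := fun p =>
    (Complex.reCLM.smulRight p.1 : ℂ →L[ℝ] E) + (Complex.imCLM.smulRight p.2 : ℂ →L[ℝ] E)
  have hΦ : Continuous Φ :=
    (((ContinuousLinearMap.smulRightL ℝ ℂ E Complex.reCLM).continuous.comp continuous_fst).add
      ((ContinuousLinearMap.smulRightL ℝ ℂ E Complex.imCLM).continuous.comp continuous_snd))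
  refine ⟨Φ '' (C ×ˢ C), (hC.prod hC).image hΦ, ?_⟩
  have key : ∀ z : ℂ, ∀ᶠ f : Complexification E in 𝓝 0, T (eval z f) ∈ C := fun z =>
    (continuous_eval z).tendsto' 0 0 rfl |>.eventually hC0
  filter_upwards [key 1, key Complex.I] with f h1 hI
  refine ⟨(T (eval 1 f), T (eval Complex.I f)), ⟨h1, hI⟩, ?_⟩
  refine ContinuousLinearMap.ext fun z => ?_
  change z.re • T (eval 1 f) + z.im • T (eval Complex.I f) = T (eval z f)
  rw [← T.map_smul, ← T.map_smul, ← T.map_add]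
  congr 1
  change z.re • (show ℂ →L[ℝ] E from f) 1 + z.im • (show ℂ →L[ℝ] E from f) Complex.I =
    (show ℂ →L[ℝ] E from f) z
  rw [← ContinuousLinearMap.map_smul, ← ContinuousLinearMap.map_smul, ← ContinuousLinearMap.map_add]
  congr 1
  apply Complex.ext <;> simp

end Complexification

/-! ### Compact operators on incomplete spaces -/

section RealSpace

variable {E : Type*} [NormedAddCommGroup E] [NormedSpace ℝ E]

theorem IsCompactOperator.exists_preimage_completion {T : E →L[ℝ] E} (hT : IsCompactOperator T) :
    ∃ C : Set E, IsCompact C ∧ T.completion ⁻¹' ((↑) '' C) ∈ 𝓝 (0 : Completion E) := by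
  obtain ⟨C, hC, hC0⟩ := hT
  refine ⟨C, hC, ?_⟩
  have hcl : IsClosed (((↑) : E → Completion E) '' C) :=
    (hC.image (Completion.continuous_coe E)).isClosed
  have h1 := Completion.isDenseInducing_coe.closure_image_mem_nhds hC0
  rw [Completion.coe_zero] at h1
  refine mem_of_superset h1 (closure_minimal ?_ (hcl.preimage T.completion.continuous))
  rintro _ ⟨x, hx, rfl⟩
  exact ⟨T x, hx, (T.completion_apply_coe x).symm⟩

theorem IsCompactOperator.completion {T : E →L[ℝ] E} (hT : IsCompactOperator T) :
    IsCompactOperator T.completion := by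
  obtain ⟨C, hC, hC0⟩ := hT.exists_preimage_completion
  exact ⟨_, hC.image (Completion.continuous_coe E), hC0⟩

/-- The extension of a compact operator to the completion takes its values in the original space:
the image of a small ball lies in a compact, hence closed, set of original points. -/
theorem IsCompactOperator.completion_apply_mem_range {T : E →L[ℝ] E} (hT : IsCompactOperator T)
    (x : Completion E) : ∃ y : E, (y : Completion E) = T.completion x := by
  obtain ⟨C, -, hC0⟩ := hT.exists_preimage_completion
  let S : Submodule ℝ (Completion E) :=
    (LinearMap.range (Completion.toComplL (𝕜 := ℝ) (E := E)).toLinearMap).comap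
      T.completion.toLinearMap
  have hS : S = ⊤ := by
    refine S.eq_top_of_nonempty_interior' ⟨0, mem_interior_iff_mem_nhds.2 ?_⟩
    refine mem_of_superset hC0 ?_
    rintro x ⟨y, -, hy⟩
    exact ⟨y, hy⟩
  have hx : x ∈ S := hS ▸ Submodule.mem_top
  exact hx

/-- An operator on a complex Banach space with spectrum contained in `{0}` has powers decaying
faster than any geometric sequence. -/
theorem tendsto_pow_mul_norm_pow_of_spectrum_subset {A : Type*} [NormedRing A] [NormedAlgebra ℂ A]
    [CompleteSpace A] (a : A) (ha : ∀ z ∈ spectrum ℂ a, z = 0) {c : ℝ} (hc : 0 ≤ c) :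
    Tendsto (fun n : ℕ => c ^ n * ‖a ^ n‖) atTop (𝓝 0) := by
  have hr : spectralRadius ℂ a = 0 := by
    refine le_antisymm (iSup₂_le fun z hz => ?_) zero_le
    simp [ha z hz]
  have h1 := spectrum.pow_norm_pow_one_div_tendsto_nhds_spectralRadius a
  rw [hr] at h1
  set d : ℝ := 1 / (2 * (c + 1)) with hd
  have hd0 : 0 < d := by positivity
  have h2 : ∀ᶠ n : ℕ in atTop, ENNReal.ofReal (‖a ^ n‖ ^ (1 / n : ℝ)) < ENNReal.ofReal d :=
    h1.eventually_lt_const (ENNReal.ofReal_pos.2 hd0)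
  have h3 : ∀ᶠ n : ℕ in atTop, c ^ n * ‖a ^ n‖ ≤ (1 / 2 : ℝ) ^ n := by
    filter_upwards [h2, eventually_ne_atTop 0] with n hn hn0
    have hlt := (ENNReal.ofReal_lt_ofReal_iff hd0).1 hn
    have hle : ‖a ^ n‖ ≤ d ^ n := by
      have := pow_le_pow_left₀ (by positivity) hlt.le n
      rwa [one_div, Real.rpow_inv_natCast_pow (norm_nonneg _) hn0] at this
    calc c ^ n * ‖a ^ n‖ ≤ c ^ n * d ^ n := by gcongr
      _ = (c * d) ^ n := (mul_pow _ _ _).symm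
      _ ≤ (1 / 2) ^ n := by
        gcongr
        rw [hd, mul_one_div, div_le_div_iff₀ (by positivity) (by positivity)]
        linarith
  exact squeeze_zero' (Eventually.of_forall fun n => by positivity) h3
    (tendsto_pow_atTop_nhds_zero_of_lt_one (by norm_num) (by norm_num))

/-- The dichotomy for a compact operator `T` on a real normed space: either `T` has a nonzero
complex eigenvalue `z`, whose effect on the real space is a vector annihilated by the quadratic
polynomial with roots `z` and its conjugate, or `T` is quasinilpotent. -/
theorem IsCompactOperator.exists_quadratic_or_tendsto {T : E →L[ℝ] E} (hT : IsCompactOperator T) :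
    (∃ a b : ℝ, b ≠ 0 ∧ ∃ x : E, x ≠ 0 ∧ T (T x) = a • T x + b • x) ∨
      ∀ (c : ℝ) (x : E), 0 ≤ c → Tendsto (fun n : ℕ => c ^ n * ‖(T ^ n) x‖) atTop (𝓝 0) := by
  let A := Complexification.map T.completion
  have hA : IsCompactOperator A := Complexification.isCompactOperator_map hT.completion
  by_cases hspec : ∀ z ∈ spectrum ℂ A, z = 0
  · right
    intro c x hc
    have h1 := (tendsto_pow_mul_norm_pow_of_spectrum_subset A hspec hc).mul_const ‖x‖
    rw [zero_mul] at h1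
    refine squeeze_zero (fun n => by positivity) (fun n => ?_) h1
    have h2 : ‖(T ^ n) x‖ = ‖(A ^ n) (Complexification.ofReal (x : Completion E))‖ := by
      rw [Complexification.map_pow_ofReal, Complexification.norm_ofReal]
      have h3 : ∀ n : ℕ, (T.completion ^ n) (x : Completion E) = ((T ^ n) x : E) := by
        intro n
        induction n with
        | zero => rfl
        | succ n ih => rw [pow_succ', pow_succ', mul_apply_eq_comp, ih,
            T.completion_apply_coe, mul_apply_eq_comp]
      rw [h3, Completion.norm_coe]
    rw [h2, mul_assoc]
    gcongr
    refine ((A ^ n).le_opNorm _).trans ?_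
    rw [Complexification.norm_ofReal, Completion.norm_coe]
  · left
    push Not at hspec
    obtain ⟨z, hz, hz0⟩ := hspec
    obtain ⟨f, hf⟩ := ((hA.hasEigenvalue_iff_mem_spectrum hz0).2 hz).exists_hasEigenvector
    have hfz : A f = z • f := hf.apply_eq_smul
    have hev : ∀ w : ℂ, T.completion (Complexification.eval w f) =
        Complexification.eval (z * w) f := fun w =>
      congrArg (Complexification.eval w) hfz
    obtain ⟨w, hw⟩ : ∃ w : ℂ, Complexification.eval w f ≠ 0 := by
      by_contra! h0
      exact hf.2 (ContinuousLinearMap.ext h0)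
    -- Since `z ≠ 0`, the value `f w` is itself a value of the extended operator.
    obtain ⟨x, hx⟩ := hT.completion_apply_mem_range (Complexification.eval (z⁻¹ * w) f)
    rw [hev, mul_inv_cancel_left₀ hz0] at hx
    refine ⟨2 * z.re, -Complex.normSq z, by simpa using hz0, x, ?_, ?_⟩
    · rintro rfl
      exact hw (by rw [← hx, Completion.coe_zero])
    · apply Completion.coe_injective E
      rw [Completion.coe_add, Completion.coe_smul, Completion.coe_smul, ← T.completion_apply_coe,
        ← T.completion_apply_coe, hx, hev, hev]
      change (show ℂ →L[ℝ] Completion E from f) _ =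
        (2 * z.re) • (show ℂ →L[ℝ] Completion E from f) _ +
          (-Complex.normSq z) • (show ℂ →L[ℝ] Completion E from f) _
      rw [← ContinuousLinearMap.map_smul, ← ContinuousLinearMap.map_smul,
        ← ContinuousLinearMap.map_add]
      congr 1
      apply Complex.ext <;> simp [Complex.normSq_apply] <;> ring

end RealSpace

/-! ### Invariant subspaces of operators commuting with a compact operator -/

section Invariant

variable {𝕜 Y : Type*} [RCLike 𝕜] [NormedAddCommGroup Y] [NormedSpace 𝕜 Y]

/-- Finite-dimensionality of a space on which `K² = a K + b` holds for a compact operator `K` and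
`b ≠ 0`: the identity is then `b⁻¹ (K - a) K`, which is compact. -/
theorem finiteDimensional_of_isCompactOperator_of_quadratic {K : Y →L[𝕜] Y}
    (hK : IsCompactOperator K) {a b : 𝕜} (hb : b ≠ 0) (h : ∀ x, K (K x) = a • K x + b • x) :
    FiniteDimensional 𝕜 Y := by
  have hid : IsCompactOperator (id : Y → Y) := by
    have h1 : IsCompactOperator ((b⁻¹ • (K - a • ContinuousLinearMap.id 𝕜 Y)) ∘ K) :=
      hK.clm_comp _
    convert! h1 using 1
    ext x
    simp [h, hb]
  obtain ⟨C, hC, hC0⟩ := hid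
  obtain ⟨r, hr, hrC⟩ := Metric.nhds_basis_closedBall.mem_iff.1 hC0
  exact FiniteDimensional.of_isCompact_closedBall 𝕜 hr
    (hC.of_isClosed_subset Metric.isClosed_closedBall hrC)

/-- If the commutant of a nonzero compact operator `K` acts with dense orbits, then `K` is not
quasinilpotent. Starting from a ball `D` around `x₀` with `0 ∉ D` and `0 ∉ closure (K D)`,
finitely many operators of the commutant suffice to move every point of `K D` back into `D`;
going back and forth `n` times gives an operator `A`, of norm at most `c ^ n`, such that
`A (K ^ n x₀)` lies in `D`. -/
theorem exists_not_tendsto_of_dense_orbits {K : Y →L[𝕜] Y} (hK : IsCompactOperator K)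
    (hK0 : K ≠ 0)
    (hdense : ∀ y : Y, y ≠ 0 → ∀ x : Y, ∀ r > 0, ∃ A : Y →L[𝕜] Y, Commute A K ∧ ‖A y - x‖ < r) :
    ∃ (c : ℝ) (x : Y), 0 ≤ c ∧ ¬ Tendsto (fun n : ℕ => c ^ n * ‖(K ^ n) x‖) atTop (𝓝 0) := by
  obtain ⟨x₀, hx₀⟩ : ∃ x, K x ≠ 0 := by
    by_contra! h0
    exact hK0 (ContinuousLinearMap.ext h0)
  have hx₀' : 0 < ‖x₀‖ := norm_pos_iff.2 fun h => hx₀ (by rw [h, map_zero])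
  have hKx₀ : 0 < ‖K x₀‖ := norm_pos_iff.2 hx₀
  obtain ⟨r, hr, hrx, hrK⟩ : ∃ r > 0, r < ‖x₀‖ ∧ ‖K‖ * r < ‖K x₀‖ := by
    refine ⟨min (‖x₀‖ / 2) (‖K x₀‖ / (2 * (‖K‖ + 1))), by positivity, ?_, ?_⟩
    · exact (min_le_left _ _).trans_lt (by linarith)
    · calc ‖K‖ * min (‖x₀‖ / 2) (‖K x₀‖ / (2 * (‖K‖ + 1)))
          ≤ ‖K‖ * (‖K x₀‖ / (2 * (‖K‖ + 1))) := by gcongr; exact min_le_right _ _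
        _ = ‖K x₀‖ * (‖K‖ / (2 * (‖K‖ + 1))) := by ring
        _ < ‖K x₀‖ * 1 := by
          gcongr
          rw [div_lt_one (by positivity)]
          linarith [norm_nonneg K]
        _ = ‖K x₀‖ := mul_one _
  obtain ⟨C, hC, hDC⟩ := IsCompactOperator.image_closedBall_subset_compact
    (f := K.toLinearMap) hK (‖x₀‖ + r)
  let S : Set Y := C ∩ Metric.closedBall (K x₀) (‖K‖ * r)
  have hS : IsCompact S := hC.inter_right Metric.isClosed_closedBall
  have hS0 : ∀ y ∈ S, y ≠ 0 := by
    rintro y ⟨-, hy⟩ rfl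
    rw [mem_closedBall_iff_norm, zero_sub, norm_neg] at hy
    linarith
  have hDS : ∀ x, ‖x - x₀‖ ≤ r → K x ∈ S := by
    intro x hx
    refine ⟨hDC ⟨x, ?_, rfl⟩, ?_⟩
    · rw [mem_closedBall_zero_iff]
      linarith [norm_le_insert' x x₀]
    · rw [mem_closedBall_iff_norm, ← map_sub]
      exact K.le_of_opNorm_le_of_le le_rfl hx
  obtain ⟨t, ht⟩ := hS.elim_finite_subcover
    (fun A : {A : Y →L[𝕜] Y // Commute A K} => {y : Y | ‖A.1 y - x₀‖ < r})
    (fun A => isOpen_lt (by fun_prop) continuous_const)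
    (fun y hy => by
      obtain ⟨A, hA, hAy⟩ := hdense y (hS0 y hy) x₀ r hr
      exact Set.mem_iUnion.2 ⟨⟨A, hA⟩, hAy⟩)
  let c : ℝ := ∑ A ∈ t, ‖A.1‖
  have hc : 0 ≤ c := Finset.sum_nonneg fun A _ => norm_nonneg _
  have key : ∀ n : ℕ, ∃ A : Y →L[𝕜] Y, Commute A K ∧ ‖A‖ ≤ c ^ n ∧
      ‖A ((K ^ n) x₀) - x₀‖ ≤ r := by
    intro n
    induction n with
    | zero => exact ⟨1, Commute.one_left K, by
        rw [pow_zero]; exact ContinuousLinearMap.norm_id_le,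
        by simpa using hr.le⟩
    | succ n ih =>
      obtain ⟨A, hAK, hAc, hAr⟩ := ih
      obtain ⟨B, hBt, hB⟩ := Set.mem_iUnion₂.1 (ht (hDS _ hAr))
      refine ⟨B.1 * A, B.2.mul_left hAK, ?_, ?_⟩
      · rw [pow_succ']
        exact (norm_mul_le _ _).trans (mul_le_mul
          (Finset.single_le_sum (f := fun A : {A : Y →L[𝕜] Y // Commute A K} => ‖A.1‖)
            (fun A _ => norm_nonneg _) hBt) hAc (norm_nonneg _) hc)
      · have h1 : A (K ((K ^ n) x₀)) = K (A ((K ^ n) x₀)) := DFunLike.congr_fun hAK.eq _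
        rw [pow_succ', mul_apply_eq_comp, mul_apply_eq_comp, h1]
        exact le_of_lt hB
  refine ⟨c, x₀, hc, fun hlim => ?_⟩
  refine absurd (ge_of_tendsto' hlim (b := ‖x₀‖ - r) fun n => ?_) (by linarith)
  obtain ⟨A, -, hAc, hAr⟩ := key n
  calc ‖x₀‖ - r ≤ ‖A ((K ^ n) x₀)‖ := by
        linarith [norm_le_insert (A ((K ^ n) x₀)) x₀]
    _ ≤ c ^ n * ‖(K ^ n) x₀‖ := A.le_of_opNorm_le hAc _

/-- A nonzero compact operator on an infinite-dimensional normed space, real or complex and not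
necessarily complete, has a nontrivial closed hyperinvariant subspace. -/
theorem IsCompactOperator.exists_hyperinvariant (hY : ¬ FiniteDimensional 𝕜 Y)
    {K : Y →L[𝕜] Y} (hK : IsCompactOperator K) (hK0 : K ≠ 0) :
    ∃ M : Submodule 𝕜 Y, M ≠ ⊥ ∧ M ≠ ⊤ ∧ IsClosed (M : Set Y) ∧
      ∀ A : Y →L[𝕜] Y, Commute A K → ∀ x ∈ M, A x ∈ M := by
  let : NormedSpace ℝ Y := NormedSpace.restrictScalars ℝ 𝕜 Y
  have : IsScalarTower ℝ 𝕜 Y := ⟨fun a b x => by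
    rw [Algebra.smul_def, mul_smul]; rfl⟩
  rcases IsCompactOperator.exists_quadratic_or_tendsto (T := K.restrictScalars ℝ) hK with
    ⟨a, b, hb, x, hx, hKx⟩ | hlim
  · replace hKx : K (K x) = (a : 𝕜) • K x + (b : 𝕜) • x := hKx
    let q : Y →L[𝕜] Y := K * K - (a : 𝕜) • K - (b : 𝕜) • 1
    have hq : ∀ y, q y = K (K y) - (a : 𝕜) • K y - (b : 𝕜) • y := fun y => rfl
    refine ⟨LinearMap.ker q.toLinearMap, ?_, ?_, q.isClosed_ker, ?_⟩
    · refine (Submodule.ne_bot_iff _).2 ⟨x, ?_, hx⟩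
      change q x = 0
      rw [hq, hKx]
      abel
    · intro htop
      refine hY (finiteDimensional_of_isCompactOperator_of_quadratic hK
        (a := (a : 𝕜)) (b := (b : 𝕜)) (by exact_mod_cast hb) fun y => ?_)
      have hy : q y = 0 := by
        have : y ∈ LinearMap.ker q.toLinearMap := htop ▸ Submodule.mem_top
        exact this
      rw [hq, sub_sub, sub_eq_zero] at hy
      exact hy
    · intro A hA y hy
      have hAq : Commute A q :=
        ((hA.mul_right hA).sub_right (hA.smul_right _)).sub_right
          ((Commute.one_right A).smul_right _)
      have h1 : A (q y) = q (A y) := DFunLike.congr_fun hAq.eq y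
      have h2 : q y = 0 := hy
      change q (A y) = 0
      rw [← h1, h2, map_zero]
  · by_contra! hM
    refine absurd hlim ?_
    push Not
    obtain ⟨c, x, hc, hn⟩ := exists_not_tendsto_of_dense_orbits hK hK0 fun y hy x r hr => by
      -- The closure of the orbit of `y` under the commutant is invariant, hence everything.
      let O : Submodule 𝕜 Y := (Subalgebra.toSubmodule (Subalgebra.centralizer 𝕜 {K})).map
        (ContinuousLinearMap.apply 𝕜 Y y).toLinearMap
      have hO : ∀ z, z ∈ O ↔ ∃ A : Y →L[𝕜] Y, Commute A K ∧ A y = z := by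
        intro z
        refine ⟨?_, ?_⟩
        · rintro ⟨A, hA, rfl⟩
          exact ⟨A, ((Subalgebra.mem_centralizer_iff 𝕜).1 hA K rfl).symm, rfl⟩
        · rintro ⟨A, hA, rfl⟩
          refine ⟨A, (Subalgebra.mem_centralizer_iff 𝕜).2 ?_, rfl⟩
          rintro _ rfl
          exact hA.eq.symm
      have hbot : O.topologicalClosure ≠ ⊥ := (Submodule.ne_bot_iff _).2
        ⟨y, O.le_topologicalClosure ((hO y).2 ⟨1, Commute.one_left K, rfl⟩), hy⟩
      have htop : O.topologicalClosure = ⊤ := by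
        by_contra htop
        obtain ⟨A, hA, z, hz, hAz⟩ := hM _ hbot htop O.isClosed_topologicalClosure
        refine hAz (map_mem_closure A.continuous hz fun w hw => ?_)
        obtain ⟨B, hB, rfl⟩ := (hO w).1 hw
        exact (hO _).2 ⟨A * B, hA.mul_left hB, rfl⟩
      have hx : x ∈ closure (O : Set Y) := by
        have : x ∈ O.topologicalClosure := htop ▸ Submodule.mem_top
        exact this
      obtain ⟨z, hz, hzr⟩ := Metric.mem_closure_iff.1 hx r hr
      obtain ⟨A, hA, rfl⟩ := (hO z).1 hz
      exact ⟨A, hA, by rwa [← dist_eq_norm, dist_comm]⟩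
    refine ⟨c, x, hc, ?_⟩
    have hpow : ∀ n : ℕ, (K.restrictScalars ℝ ^ n) x = (K ^ n) x := by
      intro n
      induction n with
      | zero => rfl
      | succ n ih => rw [pow_succ', pow_succ', mul_apply_eq_comp, ih]; rfl
    simpa only [hpow] using hn

end Invariant

/-! ### Linear relations -/

namespace LinearRelation

variable {𝕜 Y : Type*} [RCLike 𝕜] [NormedAddCommGroup Y] [NormedSpace 𝕜 Y]

theorem sub_mem_zeroValue (T : LinearRelation 𝕜 Y Y) {x u v : Y} (hu : u ∈ T x) (hv : v ∈ T x) :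
    u - v ∈ T.zeroValue := by
  have h1 : (-1 : 𝕜) • v ∈ T ((-1 : 𝕜) • x) := by
    rw [T.map_smul' _ (neg_ne_zero.2 one_ne_zero)]
    exact Set.smul_mem_smul_set hv
  have h2 : u + (-1 : 𝕜) • v ∈ T (x + (-1 : 𝕜) • x) := by
    rw [T.map_add']
    exact Set.add_mem_add hu h1
  rw [neg_one_smul, neg_one_smul, add_neg_cancel, ← sub_eq_add_neg] at h2
  exact h2

/-- A continuous linear relation with `T 0 = {0}` is a continuous linear operator. -/
theorem exists_continuousLinearMap {T : LinearRelation 𝕜 Y Y} (hT : T.Continuous)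
    (h0 : T.zeroValue = ⊥) : ∃ A : Y →L[𝕜] Y, ∀ x, T x = {A x} := by
  choose f hf using T.nonempty'
  have huniq : ∀ {x u}, u ∈ T x → u = f x := fun {x u} hu => by
    have h1 := T.sub_mem_zeroValue hu (hf x)
    rwa [h0, Submodule.mem_bot, sub_eq_zero] at h1
  refine ⟨⟨⟨⟨f, fun x y => ?_⟩, fun a x => ?_⟩, ?_⟩, fun x => ?_⟩
  · refine (huniq ?_).symm
    rw [T.map_add']
    exact Set.add_mem_add (hf x) (hf y)
  · by_cases ha : a = 0
    · subst ha
      change f ((0 : 𝕜) • x) = (0 : 𝕜) • f x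
      rw [zero_smul, zero_smul]
      exact (huniq T.zero_mem_zero).symm
    · refine (huniq ?_).symm
      rw [T.map_smul' a ha]
      exact Set.smul_mem_smul_set (hf x)
  · refine ⟨fun B hB => ?_⟩
    convert! hT B hB using 1
    ext x
    refine ⟨fun hx => ⟨f x, hf x, hx⟩, ?_⟩
    rintro ⟨u, hu, huB⟩
    rw [huniq hu] at huB
    exact huB
  · ext u
    refine ⟨fun hu => huniq hu, ?_⟩
    rintro rfl
    exact hf x

theorem isCompactOperator_of_compact {T : LinearRelation 𝕜 Y Y} (hT : T.Compact)
    (h0 : T.zeroValue = ⊥) {A : Y →L[𝕜] Y} (hA : ∀ x, T x = {A x}) : IsCompactOperator A := by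
  obtain ⟨C, hC, hBC⟩ := hT (Metric.ball 0 1) Metric.isBounded_ball
  -- As `T 0 = {0}`, the quotient map is a homeomorphism and `C` can be pulled back to `Y`.
  let e : (Y ⧸ T.zeroValue) ≃ₗ[𝕜] Y := Submodule.quotEquivOfEqBot _ h0
  have he : _root_.Continuous e := by
    refine T.zeroValue.isQuotientMap_mkQ.continuous_iff.2 ?_
    exact continuous_id
  refine ⟨e '' C, hC.image he, mem_of_superset (Metric.ball_mem_nhds 0 one_pos) fun x hx => ?_⟩
  refine ⟨T.zeroValue.mkQ (A x), hBC ⟨A x, ?_, rfl⟩, rfl⟩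
  exact Set.mem_biUnion hx (by rw [hA]; rfl)

/-- When `h 0 ≠ {0}`, a closed hyperplane `M` not containing `h 0` is weakly invariant, because
`M + h 0` is the whole space. -/
theorem exists_weaklyInvariant_of_zeroValue_ne_bot (hY : ¬ FiniteDimensional 𝕜 Y)
    {h : LinearRelation 𝕜 Y Y} (h0 : h.zeroValue ≠ ⊥) :
    ∃ M : Submodule 𝕜 Y, M ≠ ⊥ ∧ M ≠ ⊤ ∧ IsClosed (M : Set Y) ∧ h.WeaklyInvariant M := by
  obtain ⟨v, hv, hv0⟩ := (Submodule.ne_bot_iff _).1 h0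
  obtain ⟨f, hf⟩ := SeparatingDual.exists_eq_one (R := 𝕜) hv0
  refine ⟨LinearMap.ker f.toLinearMap, fun hbot => hY ?_, fun htop => ?_, f.isClosed_ker,
    fun x _ => ?_⟩
  · exact Module.Finite.of_injective f.toLinearMap (LinearMap.ker_eq_bot.1 hbot)
  · have : v ∈ LinearMap.ker f.toLinearMap := htop ▸ Submodule.mem_top
    exact one_ne_zero (hf.symm.trans this)
  · obtain ⟨y, hy⟩ := h.nonempty' x
    refine ⟨y + (-f y) • v, ?_, ?_⟩
    · have h1 : y + (-f y) • v ∈ h (x + 0) := by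
        rw [h.map_add']
        exact Set.add_mem_add hy (h.zeroValue.smul_mem _ hv)
      rwa [add_zero] at h1
    · change f (y + (-f y) • v) = 0
      simp [hf]

end LinearRelation

theorem mainTheorem1 {𝕜 Y : Type*} [RCLike 𝕜] [NormedAddCommGroup Y] [NormedSpace 𝕜 Y]
    (hY : ¬ FiniteDimensional 𝕜 Y)
    (h k : LinearRelation 𝕜 Y Y)
    (hh : h.IsLR0) (hk : k.IsLR0)
    (hcomm : k.CommutesWith h) (hcompact : k.Compact)
    (hker : k.preimage {0} ≠ Set.univ) :
    ∃ M : Submodule 𝕜 Y, M ≠ ⊥ ∧ M ≠ ⊤ ∧ IsClosed (M : Set Y) ∧ h.WeaklyInvariant M := by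
  by_cases h0 : h.zeroValue = ⊥
  swap
  · exact LinearRelation.exists_weaklyInvariant_of_zeroValue_ne_bot hY h0
  obtain ⟨H, hH⟩ := LinearRelation.exists_continuousLinearMap hh.continuous h0
  have := hk.finiteDimensional
  by_cases k0 : k.zeroValue = ⊥
  · obtain ⟨K, hK⟩ := LinearRelation.exists_continuousLinearMap hk.continuous k0
    have hKc : IsCompactOperator K := LinearRelation.isCompactOperator_of_compact hcompact k0 hK
    have hK0 : K ≠ 0 := by
      rintro rfl
      refine hker (Set.eq_univ_of_forall fun x => ⟨0, ?_, rfl⟩)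
      rw [hK]
      rfl
    have hHK : Commute H K := by
      refine ContinuousLinearMap.ext fun x => ?_
      have h1 : H (K x) ∈ k.compValue h x := hcomm x (by
        simp [LinearRelation.compValue, LinearRelation.image, hH, hK])
      simpa [LinearRelation.compValue, LinearRelation.image, hH, hK] using h1
    obtain ⟨M, hbot, htop, hcl, hM⟩ := hKc.exists_hyperinvariant hY hK0
    refine ⟨M, hbot, htop, hcl, fun x hx => ⟨H x, ?_, hM H hHK x hx⟩⟩
    rw [hH]
    rfl
  · -- Here `h 0 = {0}`, so commutation gives `h (k 0) ⊆ k (h 0) = k 0`.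
    refine ⟨k.zeroValue, k0, fun htop => hY ?_, k.zeroValue.closed_of_finiteDimensional,
      fun x hx => ⟨H x, by rw [hH]; rfl, ?_⟩⟩
    · exact Module.Finite.of_surjective k.zeroValue.subtype
        (by rw [← LinearMap.range_eq_top, Submodule.range_subtype, htop])
    · have h1 : H x ∈ k.compValue h 0 := hcomm 0 (Set.mem_biUnion hx (by rw [hH]; rfl))
      have h2 : H x ∈ k 0 := by
        simpa [LinearRelation.compValue, LinearRelation.image, hH] using h1
      exact h2
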